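/- All quantum systems are finite-dimensional, $\log$ is base $2$, and $\delta(\rho,\sigma)=\tfrac12\|\rho-\sigma\|_1$ is the trace distance. For a density operator $\rho_{XC}$ on $\mathcal H_X\otimes\mathcal H_C$, let $$H_{\min}(X|C)_\rho=\max_{\sigma_C}\,\max\{z\in\mathbb R:\ \rho_{XC}\le 2^{-z}\,\mathrm{id}_X\otimes\sigma_C\},$$ where $\sigma_C$ ranges over the density operators on $\mathcal H_C$ (and the inner maximum is $-\infty$ if there is no such $z$). Let $n_1,n_2,m\in\mathbb N$. A function $\mathrm{Ext}:\{0,1\}^{n_1}\times\{0,1\}^{n_2}\to\{0,1\}^m$ is a $(k_1,k_2,\varepsilon)$ $X_1$-strong two-source extractor against quantum product-type knowledge if $$\delta\big(\rho_{\mathrm{Ext}(X_1,X_2)X_1C_1C_2},\ \omega_m\otimes\rho_{X_1C_1C_2}\big)\le\varepsilon$$ for all states $\rho_{X_1X_2C_1C_2}=\rho_{X_1C_1}\otimes\rho_{X_2C_2}$, where $\rho_{X_iC_i}$ is a density operator that is classical on the $n_i$-bit register $X_i$ (i.e. $\rho_{X_iC_i}=\sum_{x\in\{0,1\}^{n_i}}|x\rangle\langle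 x|\otimes\rho_{C_i\wedge x}$) and $H_{\min}(X_i|C_i)_\rho\ge k_i$ for $i=1,2$. Here $\rho_{\mathrm{Ext}(X_1,X_2)X_1C_1C_2}$ is the state of the output of $\mathrm{Ext}$ together with a copy of $X_1$ and the side information, and $\omega_m=2^{-m}\,\mathrm{id}$ is the maximally mixed state on $m$ bits. It is such an extractor against classical product-type knowledge if this holds whenever, in addition, $C_1$ and $C_2$ are classical, i.e. $\rho_{X_1C_1}$ and $\rho_{X_2C_2}$ are diagonal in the fixed product bases. **Theorem.** Let $k_1,k_2\in\mathbb R$ and $\varepsilon\ge0$. Any $(k_1,k_2,\varepsilon)$ $X_1$-strong two-source extractor $\mathrm{Ext}:\{0,1\}^{n_1}\times\{0,1\}^{n_2}\to\{0,1\}^m$ against classical product-type knowledge is a $(k_1,k_2,\sqrt{2^{m-1}\varepsilon})$ $X_1$-strong two-source extractor against quantum product-type knowledge. -/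

import Mathlib

open scoped Kronecker Matrix ComplexOrder MatrixOrder

namespace TwoSource

/-- Bit strings of length `n`, i.e. `{0,1}^n`. -/
abbrev BitString (n : ℕ) : Type := Fin n → Bool

noncomputable section

/-! Operators on the Hilbert space with preferred orthonormal basis indexed by the finite type `ι`
are matrices `Matrix ι ι ℂ`; the space of a composite system `A B` has basis indexed by `A × B`.
The relation `ρ ≤ σ` on matrices is the Loewner order: `σ - ρ` is positive semidefinite. -/

/-- Density operators: positive semidefinite with trace one. -/
def IsDensity {ι : Type} [Fintype ι] (ρ : Matrix ι ι ℂ) : Prop :=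
  ρ.PosSemidef ∧ ρ.trace = 1

/-- The trace norm `‖S‖₁ = tr √(S† S)`. The trace is a nonnegative real number. -/
def traceNorm {ι : Type} [Fintype ι] [DecidableEq ι] (S : Matrix ι ι ℂ) : ℝ :=
  (CFC.sqrt (Sᴴ * S)).trace.re

/-- The trace distance `δ(ρ, σ) = ½ ‖ρ - σ‖₁`. -/
def traceDist {ι : Type} [Fintype ι] [DecidableEq ι] (ρ σ : Matrix ι ι ℂ) : ℝ :=
  traceNorm (ρ - σ) / 2

/-- The maximally mixed state `1 / d`, with `d` the dimension. -/
def maxMixed (ι : Type) [Fintype ι] [DecidableEq ι] : Matrix ι ι ℂ :=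
  (Fintype.card ι : ℂ)⁻¹ • (1 : Matrix ι ι ℂ)

/-- The operator `ρ` on `X B` is classical on `X`, i.e. of the form
`∑ₓ |x⟩⟨x| ⊗ ρₓ` (a classical-quantum operator). -/
def IsCQ {X B : Type} (ρ : Matrix (X × B) (X × B) ℂ) : Prop :=
  ∀ (x x' : X) (b b' : B), x ≠ x' → ρ (x, b) (x', b') = 0

/-- The channel that applies the classical function `f : X → Y` to the first register of an
operator on `X B`, that is `∑ₓ |f x⟩⟨f x| ⊗ ⟨x|ρ|x⟩`. -/
def applyFun {X Y B : Type} [Fintype X] [DecidableEq Y] (f : X → Y)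
    (ρ : Matrix (X × B) (X × B) ℂ) : Matrix (Y × B) (Y × B) ℂ :=
  ∑ x : X, Matrix.single (f x) (f x) (1 : ℂ) ⊗ₖ Matrix.of fun b b' => ρ (x, b) (x, b')

/-- The min-entropy of `ρ_AB` relative to `σ_B`, the largest `z` with `ρ_AB ≤ 2^(-z) 1_A ⊗ σ_B`.
It is `-∞` (the supremum of the empty set) if there is no such `z`, which is the case exactly when
`ker (1_A ⊗ σ_B)` is not contained in `ker ρ_AB`. -/
def minEntropyRel {A B : Type} [Fintype A] [DecidableEq A] [Fintype B]
    (ρ : Matrix (A × B) (A × B) ℂ) (σ : Matrix B B ℂ) : EReal :=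
  ⨆ (z : ℝ) (_ : ρ ≤ ((2 : ℝ) ^ (-z)) • ((1 : Matrix A A ℂ) ⊗ₖ σ)), (z : EReal)

/-- The conditional min-entropy `H_min(A|B)_ρ`, the maximum over density operators `σ_B` of the
min-entropy of `ρ_AB` relative to `σ_B`. -/
def minEntropy {A B : Type} [Fintype A] [DecidableEq A] [Fintype B]
    (ρ : Matrix (A × B) (A × B) ℂ) : EReal :=
  ⨆ (σ : Matrix B B ℂ) (_ : IsDensity σ), minEntropyRel ρ σ

/-- The state `ρ_{X₁C₁} ⊗ ρ_{X₂C₂}`, with its registers arranged as `(X₁ X₂) (C₁ C₂)`. -/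
def productState {X₁ X₂ C₁ C₂ : Type} (ρ₁ : Matrix (X₁ × C₁) (X₁ × C₁) ℂ)
    (ρ₂ : Matrix (X₂ × C₂) (X₂ × C₂) ℂ) :
    Matrix ((X₁ × X₂) × (C₁ × C₂)) ((X₁ × X₂) × (C₁ × C₂)) ℂ :=
  Matrix.reindex (Equiv.prodProdProdComm X₁ C₁ X₂ C₂) (Equiv.prodProdProdComm X₁ C₁ X₂ C₂)
    (ρ₁ ⊗ₖ ρ₂)

/-- For a state `ρ` on `X₁ X₂ C`, the state of the registers `Ext(X₁, X₂)`, `X₁` and `C`. -/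
def strongOutput {X₁ X₂ Y C : Type} [Fintype X₁] [Fintype X₂] [DecidableEq X₁] [DecidableEq Y]
    (Ext : X₁ × X₂ → Y) (ρ : Matrix ((X₁ × X₂) × C) ((X₁ × X₂) × C) ℂ) :
    Matrix (Y × (X₁ × C)) (Y × (X₁ × C)) ℂ :=
  Matrix.reindex (Equiv.prodAssoc Y X₁ C) (Equiv.prodAssoc Y X₁ C)
    (applyFun (fun x => (Ext x, x.1)) ρ)

/-- For a state `ρ` on `X₁ X₂ C`, the error
`δ(ρ_{Ext(X₁,X₂) X₁ C}, ω_m ⊗ ρ_{X₁ C})`. -/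
def strongError {X₁ X₂ Y C : Type} [Fintype X₁] [Fintype X₂] [Fintype Y] [Fintype C]
    [DecidableEq X₁] [DecidableEq Y] [DecidableEq C]
    (Ext : X₁ × X₂ → Y) (ρ : Matrix ((X₁ × X₂) × C) ((X₁ × X₂) × C) ℂ) : ℝ :=
  traceDist (strongOutput Ext ρ) (maxMixed Y ⊗ₖ applyFun Prod.fst ρ)

/-- `Ext` is a `(k₁, k₂, ε)` `X₁`-strong two-source extractor against quantum product-type
knowledge: the side information `C₁`, `C₂` ranges over all finite-dimensional quantum systems. -/
def IsStrongExtractorQuantum {n₁ n₂ m : ℕ} (k₁ k₂ ε : ℝ)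
    (Ext : BitString n₁ × BitString n₂ → BitString m) : Prop :=
  ∀ (C₁ C₂ : Type) [Fintype C₁] [Fintype C₂] [DecidableEq C₁] [DecidableEq C₂]
    (ρ₁ : Matrix (BitString n₁ × C₁) (BitString n₁ × C₁) ℂ)
    (ρ₂ : Matrix (BitString n₂ × C₂) (BitString n₂ × C₂) ℂ),
    IsDensity ρ₁ → IsDensity ρ₂ → IsCQ ρ₁ → IsCQ ρ₂ →
    (k₁ : EReal) ≤ minEntropy ρ₁ → (k₂ : EReal) ≤ minEntropy ρ₂ →
    strongError Ext (productState ρ₁ ρ₂) ≤ ε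

/-- `Ext` is a `(k₁, k₂, ε)` `X₁`-strong two-source extractor against classical product-type
knowledge: the side information `C₁`, `C₂` is classical too, so that the states of `X₁ C₁` and
`X₂ C₂` are diagonal in the preferred basis, i.e. joint probability distributions. -/
def IsStrongExtractorClassical {n₁ n₂ m : ℕ} (k₁ k₂ ε : ℝ)
    (Ext : BitString n₁ × BitString n₂ → BitString m) : Prop :=
  ∀ (C₁ C₂ : Type) [Fintype C₁] [Fintype C₂] [DecidableEq C₁] [DecidableEq C₂]
    (ρ₁ : Matrix (BitString n₁ × C₁) (BitString n₁ × C₁) ℂ)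
    (ρ₂ : Matrix (BitString n₂ × C₂) (BitString n₂ × C₂) ℂ),
    IsDensity ρ₁ → IsDensity ρ₂ → ρ₁.IsDiag → ρ₂.IsDiag →
    (k₁ : EReal) ≤ minEntropy ρ₁ → (k₂ : EReal) ≤ minEntropy ρ₂ →
    strongError Ext (productState ρ₁ ρ₂) ≤ ε

end

end TwoSource

/-! Write `p x` for the trace of `block ρ₁ x`, and let `D z x` be the sum over `y` of `extDev Ext z
x y` times `block ρ₂ y`. Since the side information is a product, the quantum error is at most half
the sum over `z, x` of `p x * ‖D z x‖₁`, and C₁ enters only through `p`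
(`strongError_le_of_decomposition`).

The pretty good measurement writes `block ρ₂ y` as `R * Λ y * R` with R² the reduced state on C₂.
Hence D = R L R, where L is the same combination of the `Λ y`. Cauchy–Schwarz gives ‖R L R‖₁² ≤ tr
R² · tr (L R L R) = tr (L D) (`trace_reflection_mul_sq_le`). This is linear in D: it is a sum over
outcomes c of a measurement on C₂, with coefficients `extDev Ext z x c` of modulus at most 1, so it
is bounded by a term of the error for the measured, classical side information.

A second Cauchy–Schwarz over (z, x), with weights `p x` of total mass 2^m, gives the bound ½ √(2^m ·
2ε) = √(2^(m-1) ε). The classical hypothesis applies because measuring side information cannot lower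
min-entropy (`minEntropy_le_minEntropy_measured`). -/

namespace TwoSource

open Matrix

/-! ### Trace norm, spectral calculus and the pretty good measurement. -/

section MatrixAnalysis

variable {ι κ : Type} [Fintype ι] [Fintype κ]

/-- The square root of a positive semidefinite matrix, as a positive semidefinite matrix. -/
lemma exists_posSemidef_mul_self [DecidableEq ι] {A : Matrix ι ι ℂ} (hA : A.PosSemidef) :
    ∃ B : Matrix ι ι ℂ, B.PosSemidef ∧ B * B = A :=
  ⟨CFC.sqrt A, nonneg_iff_posSemidef.1 (CFC.sqrt_nonneg A),
    CFC.sqrt_mul_sqrt_self A (nonneg_iff_posSemidef.2 hA)⟩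

lemma trace_mul_nonneg [DecidableEq ι] {A B : Matrix ι ι ℂ} (hA : A.PosSemidef)
    (hB : B.PosSemidef) : 0 ≤ (A * B).trace := by
  obtain ⟨C, hC, rfl⟩ := exists_posSemidef_mul_self hA
  have h := (hB.mul_mul_conjTranspose_same C).trace_nonneg
  rwa [hC.isHermitian.eq, trace_mul_comm, ← mul_assoc] at h

/-- With A = C², the hypothesis says that the Gram matrix of C K vanishes, so C K = 0. -/
lemma mul_eq_zero_of_conj_eq_zero [DecidableEq ι] {A K : Matrix ι ι ℂ} (hA : A.PosSemidef)
    (h : Kᴴ * A * K = 0) : A * K = 0 := by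
  obtain ⟨C, hC, rfl⟩ := exists_posSemidef_mul_self hA
  have h' : (C * K)ᴴ * (C * K) = 0 := by
    rw [conjTranspose_mul, hC.isHermitian.eq, ← h]
    simp only [mul_assoc]
  rw [mul_assoc, conjTranspose_mul_self_eq_zero.1 h', mul_zero]

/-- The Cauchy–Schwarz inequality for the Hilbert–Schmidt inner product of Hermitian matrices. -/
lemma trace_mul_sq_le {A B : Matrix ι ι ℂ} (hA : A.IsHermitian) (hB : B.IsHermitian) :
    (A * B).trace.re ^ 2 ≤ (A * A).trace.re * (B * B).trace.re := by
  -- This quadratic in t is tr (tA + B)²; being nonnegative, it has nonpositive discriminant.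
  have key (t : ℝ) : 0 ≤ (A * A).trace.re * (t * t) + 2 * (A * B).trace.re * t
      + (B * B).trace.re := by
    have hT : ((t : ℂ) • A + B).IsHermitian := by
      have h := hA.eq
      have h' := hB.eq
      simp [IsHermitian, conjTranspose_add, conjTranspose_smul, h, h']
    have h0 := (posSemidef_conjTranspose_mul_self ((t : ℂ) • A + B)).trace_nonneg
    rw [hT.eq] at h0
    have h1 := (Complex.le_def.1 h0).1
    have h2 : (((t : ℂ) • A + B) * ((t : ℂ) • A + B)).trace
        = t * t * (A * A).trace + 2 * t * (A * B).trace + (B * B).trace := by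
      simp only [add_mul, mul_add, smul_mul_assoc, mul_smul_comm, trace_add, trace_smul,
        smul_eq_mul, trace_mul_comm B A]
      ring
    rw [h2] at h1
    simp at h1
    linarith
  have := discrim_le_zero key
  rw [discrim] at this
  nlinarith

/-- Spectral decomposition with plain matrices. -/
lemma exists_spectral_decomposition [DecidableEq ι] {H : Matrix ι ι ℂ} (hH : H.IsHermitian) :
    ∃ (U : Matrix ι ι ℂ) (d : ι → ℝ), Uᴴ * U = 1 ∧ U * Uᴴ = 1 ∧
      H = U * diagonal (fun i => (d i : ℂ)) * Uᴴ := by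
  refine ⟨hH.eigenvectorUnitary, hH.eigenvalues, ?_, ?_, ?_⟩
  · exact Unitary.coe_star_mul_self hH.eigenvectorUnitary
  · exact Unitary.coe_mul_star_self hH.eigenvectorUnitary
  · exact hH.spectral_theorem

/-- The function `f` on the eigenbasis given by the columns of `U`. -/
noncomputable def spectralFun [DecidableEq ι] (U : Matrix ι ι ℂ) (f : ι → ℝ) : Matrix ι ι ℂ :=
  U * diagonal (fun i => (f i : ℂ)) * Uᴴ

section spectralFun

variable [DecidableEq ι] (U : Matrix ι ι ℂ)

lemma spectralFun_isHermitian (f : ι → ℝ) : (spectralFun U f).IsHermitian := by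
  simp [IsHermitian, spectralFun, conjTranspose_mul, mul_assoc, diagonal_conjTranspose, Pi.star_def]

lemma spectralFun_posSemidef {f : ι → ℝ} (hf : ∀ i, 0 ≤ f i) : (spectralFun U f).PosSemidef :=
  (PosSemidef.diagonal fun i => by simpa using hf i).mul_mul_conjTranspose_same U

variable {U}

lemma spectralFun_mul (hU : Uᴴ * U = 1) (f g : ι → ℝ) :
    spectralFun U f * spectralFun U g = spectralFun U (f * g) := by
  have : (fun i => ((f * g) i : ℂ)) = fun i => (f i : ℂ) * (g i : ℂ) := by funext i; simp
  rw [spectralFun, spectralFun, spectralFun, this, ← diagonal_mul_diagonal]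
  calc _ = U * diagonal (fun i => (f i : ℂ)) * (Uᴴ * U) * diagonal (fun i => (g i : ℂ)) * Uᴴ := by
        simp only [mul_assoc]
    _ = _ := by rw [hU, mul_one]; simp only [mul_assoc]

lemma spectralFun_add (f g : ι → ℝ) :
    spectralFun U f + spectralFun U g = spectralFun U (f + g) := by
  have : (fun i => ((f + g) i : ℂ)) = fun i => (f i : ℂ) + (g i : ℂ) := by funext i; simp
  rw [spectralFun, spectralFun, spectralFun, this, ← diagonal_add, mul_add, add_mul]

lemma spectralFun_sub (f g : ι → ℝ) :
    spectralFun U f - spectralFun U g = spectralFun U (f - g) := by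
  rw [sub_eq_iff_eq_add, spectralFun_add, sub_add_cancel]

lemma spectralFun_one (hU : U * Uᴴ = 1) : spectralFun U 1 = 1 := by
  simp [spectralFun, hU]

end spectralFun

/-- The Jordan decomposition of a Hermitian matrix `H` as `P - N`, together with a reflection `S`
such that `S H = |H| = P + N`. -/
lemma exists_jordan_decomposition [DecidableEq ι] {H : Matrix ι ι ℂ} (hH : H.IsHermitian) :
    ∃ S P N : Matrix ι ι ℂ, S.IsHermitian ∧ S * S = 1 ∧ P.PosSemidef ∧ N.PosSemidef ∧
      H = P - N ∧ S * H = P + N ∧ H * S = P + N := by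
  obtain ⟨U, d, hU, hU', h⟩ := exists_spectral_decomposition hH
  -- The sign of the eigenvalue, set to 1 at zero so that S squares to the identity even when H is
  -- singular.
  let s : ι → ℝ := fun i => if 0 ≤ d i then 1 else -1
  have hs : ∀ i, s i * d i = |d i| := fun i => by
    by_cases hi : 0 ≤ d i
    · simp [s, hi, abs_of_nonneg hi]
    · simp [s, hi, abs_of_neg (not_le.1 hi)]
  have hpn : (fun i => (d i)⁺) + (fun i => (d i)⁻) = fun i => |d i| := by
    funext i; exact posPart_add_negPart (d i)
  change H = spectralFun U d at h
  refine ⟨spectralFun U s, spectralFun U (fun i => (d i)⁺), spectralFun U (fun i => (d i)⁻),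
    spectralFun_isHermitian U s, ?_, spectralFun_posSemidef U fun i => posPart_nonneg _,
    spectralFun_posSemidef U fun i => negPart_nonneg _, ?_, ?_, ?_⟩
  · rw [spectralFun_mul hU, ← spectralFun_one hU']
    congr 1
    funext i
    by_cases hi : 0 ≤ d i <;> simp [s, hi]
  · rw [h, spectralFun_sub]
    congr 1
    funext i; exact (posPart_sub_negPart (d i)).symm
  · rw [h, spectralFun_mul hU, spectralFun_add, hpn]
    congr 1
    funext i; exact hs i
  · rw [h, spectralFun_mul hU, spectralFun_add, hpn]
    congr 1
    funext i; exact (mul_comm _ _).trans (hs i)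

lemma traceNorm_eq_of_sq [DecidableEq ι] {H A : Matrix ι ι ℂ} (hA : A.PosSemidef)
    (h : A * A = Hᴴ * H) : traceNorm H = A.trace.re := by
  rw [traceNorm, CFC.sqrt_unique h (nonneg_iff_posSemidef.2 hA)]

/-- The trace norm is tr S(P - N) for a reflection S; since -1 ≤ S ≤ 1, tr SP ≤ tr P and -tr SN ≤ tr
N. -/
lemma traceNorm_sub_le [DecidableEq ι] {P N : Matrix ι ι ℂ} (hP : P.PosSemidef)
    (hN : N.PosSemidef) : traceNorm (P - N) ≤ P.trace.re + N.trace.re := by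
  have hH : (P - N).IsHermitian := hP.isHermitian.sub hN.isHermitian
  obtain ⟨S, P', N', hS, hSS, hP', hN', -, h1, h2⟩ := exists_jordan_decomposition hH
  have h3 : (P' + N') * (P' + N') = (P - N)ᴴ * (P - N) := by
    nth_rw 1 [← h2]
    rw [← h1, hH.eq, mul_assoc, ← mul_assoc S, hSS, one_mul]
  have hs : (1 - S).PosSemidef ∧ (1 + S).PosSemidef := by
    have e1 : (1 - S) * (1 - S) = (2 : ℝ) • (1 - S) := by
      simp only [sub_mul, mul_sub, hSS, mul_one, one_mul, two_smul]; abel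
    have e2 : (1 + S) * (1 + S) = (2 : ℝ) • (1 + S) := by
      simp only [add_mul, mul_add, hSS, mul_one, one_mul, two_smul]; abel
    have p1 := posSemidef_conjTranspose_mul_self (1 - S)
    have p2 := posSemidef_conjTranspose_mul_self (1 + S)
    rw [(isHermitian_one.sub hS).eq, e1] at p1
    rw [(isHermitian_one.add hS).eq, e2] at p2
    constructor
    · simpa [smul_smul] using p1.smul (show (0 : ℝ) ≤ 1 / 2 by norm_num)
    · simpa [smul_smul] using p2.smul (show (0 : ℝ) ≤ 1 / 2 by norm_num)
  rw [traceNorm_eq_of_sq (hP'.add hN') h3, ← h1]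
  have t1 := (Complex.le_def.1 (trace_mul_nonneg hs.1 hP)).1
  have t2 := (Complex.le_def.1 (trace_mul_nonneg hs.2 hN)).1
  simp only [sub_mul, add_mul, one_mul, trace_sub, trace_add, Complex.sub_re, Complex.add_re,
    Complex.zero_re, mul_sub] at t1 t2 ⊢
  linarith

lemma traceNorm_diagonal [DecidableEq ι] (d : ι → ℝ) :
    traceNorm (diagonal fun i => (d i : ℂ)) = ∑ i, |d i| := by
  rw [traceNorm_eq_of_sq (A := diagonal fun i => ((|d i| : ℝ) : ℂ))
    (PosSemidef.diagonal fun i => by simp)]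
  · simp [trace_diagonal]
  · rw [diagonal_conjTranspose, diagonal_mul_diagonal, diagonal_mul_diagonal]
    congr 1
    funext i
    simp [← Complex.ofReal_mul]

/-- The trace norm of `R L R` is bounded by a Hilbert–Schmidt type norm: this is the bound for
`tr (S R L R)` with a reflection `S`. -/
lemma trace_reflection_mul_sq_le [DecidableEq ι] {S R L : Matrix ι ι ℂ} (hS : S.IsHermitian)
    (hSS : S * S = 1) (hR : R.PosSemidef) (hL : L.IsHermitian) :
    (S * (R * L * R)).trace.re ^ 2 ≤ (R * R).trace.re * (L * (R * L * R)).trace.re := by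
  have hR' := hR.isHermitian
  -- The commutator of S and R has nonnegative squared Hilbert–Schmidt norm, which expands to 2 tr
  -- R² - 2 tr (SRSR).
  have hSR : (S * R * S * R).trace.re ≤ (R * R).trace.re := by
    have h := (posSemidef_conjTranspose_mul_self (S * R - R * S)).trace_nonneg
    rw [conjTranspose_sub, conjTranspose_mul, conjTranspose_mul, hS.eq, hR'.eq] at h
    have e : ((R * S - S * R) * (S * R - R * S)).trace
        = 2 * (R * R).trace - 2 * (S * R * S * R).trace := by
      have e1 : R * S * (S * R) = R * R := by
        rw [mul_assoc, ← mul_assoc S, hSS, one_mul]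
      have e2 : (S * R * (R * S)).trace = (R * R).trace := by
        rw [trace_mul_comm, e1]
      have e3 : (R * S * (R * S)).trace = (S * R * S * R).trace := by
        rw [trace_mul_comm, mul_assoc, trace_mul_comm]; simp only [mul_assoc]
      have e4 : S * R * (S * R) = S * R * S * R := by simp only [mul_assoc]
      rw [sub_mul, mul_sub, mul_sub, trace_sub, trace_sub, trace_sub, e1, e2, e3, e4]
      ring
    rw [e] at h
    have := (Complex.le_def.1 h).1
    simp at this
    linarith
  -- With R = Q², Cauchy–Schwarz is applied to the Hermitian matrices Q S Q and Q L Q.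
  obtain ⟨Q, hQ, rfl⟩ := exists_posSemidef_mul_self hR
  have hQ' := hQ.isHermitian.eq
  have hA : (Q * S * Q).IsHermitian := by
    simp [IsHermitian, conjTranspose_mul, hQ', hS.eq, mul_assoc]
  have hB : (Q * L * Q).IsHermitian := by
    simp [IsHermitian, conjTranspose_mul, hQ', hL.eq, mul_assoc]
  have h := trace_mul_sq_le hA hB
  have cyc (X Y : Matrix ι ι ℂ) : (Q * X * Q * (Q * Y * Q)).trace
      = (X * ((Q * Q) * Y * (Q * Q))).trace := by
    rw [mul_assoc Q X, mul_assoc Q, trace_mul_comm]; simp only [mul_assoc]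
  rw [cyc, cyc, cyc] at h
  have hLL : 0 ≤ (L * (Q * Q * L * (Q * Q))).trace.re := by
    rw [← cyc]
    have := (posSemidef_conjTranspose_mul_self (Q * L * Q)).trace_nonneg
    rw [hB.eq] at this
    exact (Complex.le_def.1 this).1
  refine h.trans (mul_le_mul_of_nonneg_right ?_ hLL)
  simpa only [mul_assoc] using hSR

/-- The pretty good measurement of a family of positive semidefinite matrices. -/
lemma exists_prettyGoodMeasurement [DecidableEq ι] [DecidableEq κ] [Nonempty κ]
    {τ : κ → Matrix ι ι ℂ} (hτ : ∀ k, (τ k).PosSemidef) :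
    ∃ (R : Matrix ι ι ℂ) (Λ : κ → Matrix ι ι ℂ), R.PosSemidef ∧ R * R = ∑ k, τ k ∧
      (∀ k, (Λ k).PosSemidef) ∧ ∑ k, Λ k = 1 ∧ ∀ k, τ k = R * Λ k * R := by
  have hsum : (∑ k, τ k).PosSemidef := posSemidef_sum _ fun k _ => hτ k
  obtain ⟨U, d, hU, hU', h⟩ := exists_spectral_decomposition hsum.isHermitian
  have hd : ∀ i, 0 ≤ d i := by
    have h' := hsum.conjTranspose_mul_mul_same U
    have e : Uᴴ * (∑ k, τ k) * U = diagonal fun i => (d i : ℂ) := by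
      rw [h]
      calc _ = (Uᴴ * U) * (diagonal fun i => (d i : ℂ)) * (Uᴴ * U) := by simp only [mul_assoc]
        _ = _ := by rw [hU, one_mul, mul_one]
    rw [e, posSemidef_diagonal_iff] at h'
    exact fun i => by simpa using h' i
  change _ = spectralFun U d at h
  let r : ι → ℝ := fun i => √(d i)
  -- As 0⁻¹ = 0, this is the pseudo-inverse of `r`: `r * q` indicates the support of the sum and `1
  -- - r * q` its kernel.
  let q : ι → ℝ := fun i => (√(d i))⁻¹
  have hrr : r * r = d := funext fun i => Real.mul_self_sqrt (hd i)
  have hrp : r * (1 - r * q) = 0 := funext fun i => by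
    by_cases hi : √(d i) = 0 <;> simp [r, q, hi]
  have hpp : (1 - r * q) * (1 - r * q) = 1 - r * q := funext fun i => by
    by_cases hi : √(d i) = 0 <;> simp [r, q, hi]
  have hpd : (1 - r * q) * d = 0 := by rw [← hrr, mul_comm, mul_assoc, hrp, mul_zero]
  have hqdq : q * d * q = r * q := funext fun i => by
    rw [← hrr]
    by_cases hi : √(d i) = 0 <;> simp [r, q, hi]
  have h00 : spectralFun U 0 = 0 := by simp [spectralFun]
  set R := spectralFun U r with hRdef
  set Q := spectralFun U q with hQdef
  set K := spectralFun U (1 - r * q) with hKdef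
  have hK : K.IsHermitian := spectralFun_isHermitian U _
  have hQh : Q.IsHermitian := spectralFun_isHermitian U _
  have hKp : K.PosSemidef := by
    have := posSemidef_conjTranspose_mul_self K
    rwa [hK.eq, hKdef, spectralFun_mul hU, hpp] at this
  have hRK : R * K = 0 := by rw [spectralFun_mul hU, hrp, h00]
  have hRQ : R * Q = 1 - K := by
    rw [spectralFun_mul hU, ← spectralFun_one hU', spectralFun_sub, sub_sub_cancel]
  have hQR : Q * R = 1 - K := by
    rw [spectralFun_mul hU, ← spectralFun_one hU', spectralFun_sub, sub_sub_cancel, mul_comm]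
  -- Each `τ k` lives on the support: 0 ≤ K τₖ K ≤ K (∑ τ) K = 0.
  have hτK (k) : τ k * K = 0 := by
    apply mul_eq_zero_of_conj_eq_zero (hτ k)
    have hle : (K * τ k * K) ≤ 0 := by
      have h1 : K * (∑ k, τ k) * K = 0 := by
        rw [h, spectralFun_mul hU, hpd, h00, zero_mul]
      rw [← h1, Finset.mul_sum, Finset.sum_mul]
      refine Finset.single_le_sum (f := fun k => K * τ k * K) (fun j _ => ?_) (Finset.mem_univ k)
      have := (hτ j).conjTranspose_mul_mul_same K
      rw [hK.eq] at this
      exact nonneg_iff_posSemidef.2 this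
    have hge : 0 ≤ K * τ k * K := by
      have := (hτ k).conjTranspose_mul_mul_same K
      rw [hK.eq] at this
      exact nonneg_iff_posSemidef.2 this
    rw [hK.eq]
    exact le_antisymm hle hge
  have hKτ (k) : K * τ k = 0 := by
    have := congrArg conjTranspose (hτK k)
    rwa [conjTranspose_mul, hK.eq, (hτ k).isHermitian.eq, conjTranspose_zero] at this
  obtain ⟨k₀⟩ := ‹Nonempty κ›
  -- The elements Q τₖ Q sum only to the support projection. Adding K to one outcome completes the
  -- measurement, and R K = 0 makes this invisible in R Λₖ R.
  refine ⟨R, fun k => Q * τ k * Q + if k = k₀ then K else 0,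
    spectralFun_posSemidef U fun i => Real.sqrt_nonneg _, ?_, fun k => ?_, ?_, fun k => ?_⟩
  · rw [h, spectralFun_mul hU, hrr]
  · have h1 : (Q * τ k * Q).PosSemidef := by
      have := (hτ k).conjTranspose_mul_mul_same Q
      rwa [hQh.eq] at this
    refine h1.add ?_
    split_ifs
    · exact hKp
    · exact PosSemidef.zero
  · rw [Finset.sum_add_distrib, ← Finset.sum_mul, ← Finset.mul_sum, h, spectralFun_mul hU,
      spectralFun_mul hU, hqdq]
    simp only [Finset.sum_ite_eq', Finset.mem_univ, if_true]
    rw [hKdef, spectralFun_add, add_sub_cancel, spectralFun_one hU']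
  · have h1 : R * (if k = k₀ then K else 0) = 0 := by split_ifs <;> simp [hRK]
    rw [mul_add, h1, add_zero]
    calc τ k = (1 - K) * τ k * (1 - K) := by
          rw [sub_mul, mul_sub, hKτ]
          simp [hτK]
      _ = _ := by rw [← hRQ]; nth_rw 2 [hRQ]; rw [← hQR]; simp only [mul_assoc]

end MatrixAnalysis

/-! ### Diagonal blocks of classical-quantum operators. -/

section Blocks

variable {X B : Type}

/-- The diagonal block `⟨x|ρ|x⟩` of an operator on `X B`. -/
def block (ρ : Matrix (X × B) (X × B) ℂ) (x : X) : Matrix B B ℂ :=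
  Matrix.of fun b b' => ρ (x, b) (x, b')

lemma block_posSemidef {ρ : Matrix (X × B) (X × B) ℂ} (hρ : ρ.PosSemidef) (x : X) :
    (block ρ x).PosSemidef :=
  hρ.submatrix fun b => (x, b)

lemma sum_trace_block [Fintype X] [Fintype B] (ρ : Matrix (X × B) (X × B) ℂ) :
    ∑ x, (block ρ x).trace = ρ.trace := by
  simp [block, trace, Fintype.sum_prod_type]

lemma block_le [Fintype X] [Fintype B] [DecidableEq X] {ρ : Matrix (X × B) (X × B) ℂ}
    {σ : Matrix B B ℂ} {t : ℝ} (h : ρ ≤ t • ((1 : Matrix X X ℂ) ⊗ₖ σ)) (x : X) :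
    block ρ x ≤ t • σ := by
  have e : t • σ - block ρ x = block (t • ((1 : Matrix X X ℂ) ⊗ₖ σ) - ρ) x := by
    ext b b'
    simp [block]
  rw [le_iff, e]
  exact block_posSemidef (le_iff.1 h) x

end Blocks

/-! ### The extractor error as a sum over output z and source value x. -/

section Error

variable {X₁ X₂ Y C₁ C₂ : Type} [Fintype Y] [DecidableEq Y]

/-- The deviation of the indicator of `Ext (x, y) = z` from the uniform probability. -/
noncomputable def extDev (Ext : X₁ × X₂ → Y) (z : Y) (x : X₁) (y : X₂) : ℝ :=
  (if Ext (x, y) = z then 1 else 0) - (Fintype.card Y : ℝ)⁻¹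

lemma abs_extDev_le (Ext : X₁ × X₂ → Y) (z : Y) (x : X₁) (y : X₂) :
    |extDev Ext z x y| ≤ 1 := by
  have h0 : (0 : ℝ) ≤ (Fintype.card Y : ℝ)⁻¹ := by positivity
  have h1 : (Fintype.card Y : ℝ)⁻¹ ≤ 1 := Nat.cast_inv_le_one _
  rw [abs_le, extDev]
  split_ifs <;> constructor <;> linarith

variable [Fintype X₁] [Fintype X₂] [DecidableEq X₁]

/-- Both states are block diagonal in (z, x). Fixing x leaves only y to be averaged, so each block
factorizes between C₁ and C₂. -/
lemma strongOutput_sub_eq (Ext : X₁ × X₂ → Y) (ρ₁ : Matrix (X₁ × C₁) (X₁ × C₁) ℂ)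
    (ρ₂ : Matrix (X₂ × C₂) (X₂ × C₂) ℂ) :
    strongOutput Ext (productState ρ₁ ρ₂) - maxMixed Y ⊗ₖ applyFun Prod.fst (productState ρ₁ ρ₂)
      = ∑ z, ∑ x, single z z (1 : ℂ) ⊗ₖ (single x x (1 : ℂ) ⊗ₖ
          (block ρ₁ x ⊗ₖ ∑ y, (extDev Ext z x y : ℂ) • block ρ₂ y)) := by
  ext ⟨z, x, c₁, c₂⟩ ⟨z', x', c₁', c₂'⟩
  have e1 : strongOutput Ext (productState ρ₁ ρ₂) (z, x, c₁, c₂) (z', x', c₁', c₂')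
      = if z = z' ∧ x = x' then
        ∑ y, if Ext (x, y) = z then ρ₁ (x, c₁) (x, c₁') * ρ₂ (y, c₂) (y, c₂') else 0 else 0 := by
    simp only [strongOutput, productState, applyFun, reindex_apply, submatrix_apply, Matrix.sum_apply,
      kroneckerMap_apply, Fintype.sum_prod_type, single_apply, of_apply]
    by_cases hx : x = x'
    · subst hx
      rw [Finset.sum_eq_single x]
      · by_cases hz : z = z'
        · subst hz; simp
        · have : ∀ y, ¬ (Ext (x, y) = z ∧ Ext (x, y) = z') := fun y h => hz (h.1.symm.trans h.2)
          simp [hz, this]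
      · intro a _ ha; simp [ha]
      · simp
    · rw [Finset.sum_eq_zero]
      · simp [hx]
      · intro a _
        have : ¬ (a = x ∧ a = x') := fun h => hx (h.1.symm.trans h.2)
        refine Finset.sum_eq_zero fun y _ => ?_
        have h' : ¬ ((Ext (a, y), a) = (z, x) ∧ (Ext (a, y), a) = (z', x')) := fun h =>
          this ⟨congrArg Prod.snd h.1, congrArg Prod.snd h.2⟩
        simp_all
  have e2 : applyFun Prod.fst (productState ρ₁ ρ₂) (x, c₁, c₂) (x', c₁', c₂')
      = if x = x' then ∑ y, ρ₁ (x, c₁) (x, c₁') * ρ₂ (y, c₂) (y, c₂') else 0 := by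
    simp only [productState, applyFun, reindex_apply, submatrix_apply, Matrix.sum_apply,
      kroneckerMap_apply, Fintype.sum_prod_type, single_apply, of_apply]
    by_cases hx : x = x'
    · subst hx
      rw [Finset.sum_eq_single x]
      · simp
      · intro a _ ha; simp [ha]
      · simp
    · rw [Finset.sum_eq_zero]
      · simp [hx]
      · intro a _
        have : ¬ (a = x ∧ a = x') := fun h => hx (h.1.symm.trans h.2)
        simp [this]
  have e3 : (∑ z, ∑ x, single z z (1 : ℂ) ⊗ₖ (single x x (1 : ℂ) ⊗ₖ
        (block ρ₁ x ⊗ₖ ∑ y, (extDev Ext z x y : ℂ) • block ρ₂ y)) :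
          Matrix (Y × X₁ × C₁ × C₂) (Y × X₁ × C₁ × C₂) ℂ) (z, x, c₁, c₂) (z', x', c₁', c₂')
      = if z = z' ∧ x = x' then
        ∑ y, (extDev Ext z x y : ℂ) * (ρ₁ (x, c₁) (x, c₁') * ρ₂ (y, c₂) (y, c₂')) else 0 := by
    simp only [Matrix.sum_apply, kroneckerMap_apply, single_apply, block, of_apply, Matrix.smul_apply]
    by_cases h : z = z' ∧ x = x'
    · obtain ⟨rfl, rfl⟩ := h
      rw [Finset.sum_eq_single z, Finset.sum_eq_single x]
      · simp [Finset.mul_sum, mul_left_comm]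
      · intro a _ ha; simp [ha]
      · simp
      · intro a _ ha; simp [ha]
      · simp
    · rw [if_neg h]
      refine Finset.sum_eq_zero fun a _ => Finset.sum_eq_zero fun b _ => ?_
      by_cases h1 : a = z ∧ a = z'
      · have : ¬ (b = x ∧ b = x') := fun h2 =>
          h ⟨h1.1.symm.trans h1.2, h2.1.symm.trans h2.2⟩
        simp [this]
      · simp [h1]
  rw [Matrix.sub_apply, e1, e3, kroneckerMap_apply, e2, maxMixed, Matrix.smul_apply, one_apply]
  by_cases hz : z = z'
  · by_cases hx : x = x'
    · simp only [hz, hx, and_self, if_true, smul_eq_mul, mul_one, Finset.mul_sum, extDev]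
      rw [← Finset.sum_sub_distrib]
      refine Finset.sum_congr rfl fun y _ => ?_
      split_ifs <;> simp [sub_mul]
    · simp [hx]
  · simp [hz]

lemma single_one_posSemidef {ι : Type} [DecidableEq ι] [Fintype ι] (i : ι) :
    (single i i (1 : ℂ)).PosSemidef := by
  rw [← diagonal_single]
  refine PosSemidef.diagonal fun j => ?_
  by_cases h : j = i
  · subst h; simp
  · simp [h]

variable [Fintype C₁] [Fintype C₂] [DecidableEq C₁] [DecidableEq C₂]

/-- The error in terms of Jordan decompositions of the conditional operators on `C₂`. -/
lemma strongError_le_of_decomposition (Ext : X₁ × X₂ → Y) {ρ₁ : Matrix (X₁ × C₁) (X₁ × C₁) ℂ}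
    (hρ₁ : ρ₁.PosSemidef) (ρ₂ : Matrix (X₂ × C₂) (X₂ × C₂) ℂ) {P N : Y → X₁ → Matrix C₂ C₂ ℂ}
    (hP : ∀ z x, (P z x).PosSemidef) (hN : ∀ z x, (N z x).PosSemidef)
    (h : ∀ z x, ∑ y, (extDev Ext z x y : ℂ) • block ρ₂ y = P z x - N z x) :
    strongError Ext (productState ρ₁ ρ₂)
      ≤ (∑ z, ∑ x, (block ρ₁ x).trace.re * (P z x + N z x).trace.re) / 2 := by
  have hpsd {F : Y → X₁ → Matrix C₂ C₂ ℂ} (hF : ∀ z x, (F z x).PosSemidef) :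
      (∑ z, ∑ x, single z z (1 : ℂ) ⊗ₖ (single x x (1 : ℂ) ⊗ₖ
        (block ρ₁ x ⊗ₖ F z x))).PosSemidef :=
    posSemidef_sum _ fun z _ => posSemidef_sum _ fun x _ =>
      (single_one_posSemidef z).kronecker ((single_one_posSemidef x).kronecker
        ((block_posSemidef hρ₁ x).kronecker (hF z x)))
  have htr {F : Y → X₁ → Matrix C₂ C₂ ℂ} (hF : ∀ z x, (F z x).PosSemidef) :
      (∑ z, ∑ x, single z z (1 : ℂ) ⊗ₖ (single x x (1 : ℂ) ⊗ₖ
        (block ρ₁ x ⊗ₖ F z x))).trace.re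
        = ∑ z, ∑ x, (block ρ₁ x).trace.re * (F z x).trace.re := by
    simp only [trace_sum, trace_kronecker, trace_single_eq_same, one_mul, Complex.re_sum,
      Complex.mul_re]
    refine Finset.sum_congr rfl fun z _ => Finset.sum_congr rfl fun x _ => ?_
    rw [← (Complex.le_def.1 (hF z x).trace_nonneg).2]
    simp
  rw [strongError, traceDist, strongOutput_sub_eq]
  refine div_le_div_of_nonneg_right ?_ zero_le_two
  have e : (∑ z, ∑ x, single z z (1 : ℂ) ⊗ₖ (single x x (1 : ℂ) ⊗ₖ
      (block ρ₁ x ⊗ₖ ∑ y, (extDev Ext z x y : ℂ) • block ρ₂ y)))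
      = (∑ z, ∑ x, single z z (1 : ℂ) ⊗ₖ (single x x (1 : ℂ) ⊗ₖ (block ρ₁ x ⊗ₖ P z x)))
        - ∑ z, ∑ x, single z z (1 : ℂ) ⊗ₖ (single x x (1 : ℂ) ⊗ₖ (block ρ₁ x ⊗ₖ N z x)) := by
    have hsub {l m : Type} (A : Matrix l l ℂ) (B C : Matrix m m ℂ) :
        A ⊗ₖ (B - C) = A ⊗ₖ B - A ⊗ₖ C := by
      ext; simp [mul_sub]
    simp only [h, hsub, Finset.sum_sub_distrib]
  rw [e]
  -- `block ρ₁ x` is a positive tensor factor of both parts, so only its trace survives and C₁ drops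
  -- out.
  refine (traceNorm_sub_le (hpsd hP) (hpsd hN)).trans_eq ?_
  rw [htr hP, htr hN, ← Finset.sum_add_distrib]
  refine Finset.sum_congr rfl fun z _ => ?_
  rw [← Finset.sum_add_distrib]
  refine Finset.sum_congr rfl fun x _ => ?_
  rw [trace_add, Complex.add_re, mul_add]

/-- The error for classical side information, with trivial `C₁`. -/
lemma strongError_diagonal [DecidableEq X₂] (Ext : X₁ × X₂ → Y) (p : X₁ → ℝ) (w : X₂ → C₂ → ℝ) :
    strongError Ext (productState (diagonal fun i : X₁ × Unit => (p i.1 : ℂ))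
        (diagonal fun i : X₂ × C₂ => (w i.1 i.2 : ℂ)))
      = (∑ z, ∑ x, ∑ c, |p x * ∑ y, extDev Ext z x y * w y c|) / 2 := by
  have e : (∑ z, ∑ x, single z z (1 : ℂ) ⊗ₖ (single x x (1 : ℂ) ⊗ₖ
      (block (diagonal fun i : X₁ × Unit => (p i.1 : ℂ)) x ⊗ₖ
        ∑ y, (extDev Ext z x y : ℂ) • block (diagonal fun i : X₂ × C₂ => (w i.1 i.2 : ℂ)) y)))
      = diagonal fun i : Y × X₁ × Unit × C₂ =>
        ((p i.2.1 * ∑ y, extDev Ext i.1 i.2.1 y * w y i.2.2.2 : ℝ) : ℂ) := by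
    have b1 (x) : block (diagonal fun i : X₁ × Unit => (p i.1 : ℂ)) x
        = diagonal fun _ : Unit => (p x : ℂ) := by
      ext; simp [block]
    have b2 (y) : block (diagonal fun i : X₂ × C₂ => (w i.1 i.2 : ℂ)) y
        = diagonal fun c => (w y c : ℂ) := by
      ext c c'; simp [block, diagonal_apply]
    have b3 (z x) : ∑ y, (extDev Ext z x y : ℂ) • diagonal (fun c => (w y c : ℂ))
        = diagonal fun c => ((∑ y, extDev Ext z x y * w y c : ℝ) : ℂ) := by
      ext c c'
      simp only [Matrix.sum_apply, Matrix.smul_apply, diagonal_apply]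
      by_cases h : c = c' <;> simp [h]
    simp only [b1, b2, b3, ← diagonal_single, diagonal_kronecker_diagonal]
    ext ⟨z, x, u, c⟩ j
    by_cases h : (z, x, u, c) = j
    · subst h
      simp only [Matrix.sum_apply, diagonal_apply_eq]
      rw [Finset.sum_eq_single z, Finset.sum_eq_single x]
      · simp
      · intro a _ ha; simp [ha.symm]
      · simp
      · intro a _ ha; simp [ha.symm]
      · simp
    · simp [Matrix.sum_apply, diagonal_apply_ne _ h]
  rw [strongError, traceDist, strongOutput_sub_eq, e, traceNorm_diagonal]
  simp [Fintype.sum_prod_type]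

end Error

/-! ### Measuring side information. -/

section Measurement

variable {X B C : Type} [Fintype B]

/-- The classical state obtained from a classical-quantum state by measuring the quantum register
with the measurement operators `Λ`. -/
noncomputable def measured [DecidableEq X] [DecidableEq C] (ρ : Matrix (X × B) (X × B) ℂ) (Λ : C → Matrix B B ℂ) :
    Matrix (X × C) (X × C) ℂ :=
  diagonal fun i => (((block ρ i.1 * Λ i.2).trace.re : ℝ) : ℂ)

variable [Fintype C] [DecidableEq B] {Λ : C → Matrix B B ℂ}

lemma sum_trace_mul_re (hΛ : ∑ c, Λ c = 1) (σ : Matrix B B ℂ) :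
    ∑ c, (σ * Λ c).trace.re = σ.trace.re := by
  rw [← Complex.re_sum, ← trace_sum, ← Finset.mul_sum, hΛ, mul_one]

variable [Fintype X] [DecidableEq X] [DecidableEq C] {ρ : Matrix (X × B) (X × B) ℂ}

lemma measured_isDensity (hρ : IsDensity ρ) (hΛ₀ : ∀ c, (Λ c).PosSemidef) (hΛ : ∑ c, Λ c = 1) :
    IsDensity (measured ρ Λ) := by
  constructor
  · refine PosSemidef.diagonal fun i => ?_
    have := (Complex.le_def.1 (trace_mul_nonneg (block_posSemidef hρ.1 i.1) (hΛ₀ i.2))).1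
    simpa using this
  · rw [measured, trace_diagonal, Fintype.sum_prod_type, ← Complex.ofReal_one]
    simp only [← Complex.ofReal_sum]
    congr 1
    simp only [sum_trace_mul_re hΛ]
    rw [← Complex.re_sum, sum_trace_block, hρ.2, Complex.one_re]

/-- Measuring the side information does not decrease the min-entropy. -/
lemma minEntropy_le_minEntropy_measured (hΛ₀ : ∀ c, (Λ c).PosSemidef) (hΛ : ∑ c, Λ c = 1) :
    minEntropy ρ ≤ minEntropy (measured ρ Λ) := by
  refine iSup₂_le fun σ hσ => iSup₂_le fun z hz => ?_
  -- The outcome distribution of σ is the classical witness, with the same z.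
  let s : C → ℝ := fun c => (σ * Λ c).trace.re
  have hs : IsDensity (diagonal fun c => (s c : ℂ)) := by
    constructor
    · refine PosSemidef.diagonal fun c => ?_
      have := (Complex.le_def.1 (trace_mul_nonneg hσ.1 (hΛ₀ c))).1
      simpa using this
    · rw [trace_diagonal, ← Complex.ofReal_sum, sum_trace_mul_re hΛ, hσ.2]
      simp
  refine le_trans ?_ (le_iSup₂ (f := fun σ (_ : IsDensity σ) => minEntropyRel (measured ρ Λ) σ) _ hs)
  refine le_iSup₂ (f := fun (z : ℝ) (_ : measured ρ Λ ≤ ((2 : ℝ) ^ (-z)) •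
    ((1 : Matrix X X ℂ) ⊗ₖ diagonal fun c => (s c : ℂ))) => (z : EReal)) z ?_
  have e : ((2 : ℝ) ^ (-z)) • ((1 : Matrix X X ℂ) ⊗ₖ diagonal fun c => (s c : ℂ)) - measured ρ Λ
      = diagonal fun i : X × C =>
        (((2 : ℝ) ^ (-z) * s i.2 - (block ρ i.1 * Λ i.2).trace.re : ℝ) : ℂ) := by
    rw [measured, ← diagonal_one, diagonal_kronecker_diagonal, ← diagonal_smul, diagonal_sub]
    congr 1
    funext i
    simp
  rw [le_iff, e]
  refine PosSemidef.diagonal fun i => ?_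
  -- Tracing the blockwise operator inequality against `Λ` gives the inequality for each outcome.
  have h := (Complex.le_def.1 (trace_mul_nonneg (le_iff.1 (block_le hz i.1)) (hΛ₀ i.2))).1
  rw [sub_mul, trace_sub, smul_mul_assoc, trace_smul, Complex.sub_re, Complex.smul_re] at h
  simpa only [Pi.zero_apply, Complex.zero_le_real, smul_eq_mul, Complex.zero_re] using h

end Measurement

/-! ### Comparison of the quantum error with the measured error. -/

/-- Half of a weighted sum of first moments, bounded through second moments. -/
lemma half_sum_mul_le_sqrt {ι : Type} [Fintype ι] {p t a : ι → ℝ} {M b : ℝ} (hp : ∀ i, 0 ≤ p i)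
    (ht : ∀ i, t i ^ 2 ≤ a i) (hM : ∑ i, p i = M) (hM₀ : 0 ≤ M) (hb : ∑ i, p i * a i ≤ b) :
    (∑ i, p i * t i) / 2 ≤ √(M * b / 4) := by
  refine Real.le_sqrt_of_sq_le ?_
  have h1 : (∑ i, p i * t i) ^ 2 ≤ (∑ i, p i) * ∑ i, p i * t i ^ 2 :=
    Finset.sum_sq_le_sum_mul_sum_of_sq_le_mul _ (fun i _ => hp i)
      (fun i _ => mul_nonneg (hp i) (sq_nonneg _)) fun i _ => le_of_eq (by ring)
  have h2 : ∑ i, p i * t i ^ 2 ≤ b :=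
    (Finset.sum_le_sum fun i _ => mul_le_mul_of_nonneg_left (ht i) (hp i)).trans hb
  rw [hM] at h1
  have := h1.trans (mul_le_mul_of_nonneg_left h2 hM₀)
  linarith [div_pow (∑ i, p i * t i) 2 2]

/-- The error with quantum side information is controlled by the error after measuring `C₂` with
the pretty good measurement and discarding `C₁`. -/
lemma exists_measurement_strongError_le {X₁ X₂ Y C₁ C₂ : Type} [Fintype X₁] [Fintype X₂]
    [Fintype Y] [Fintype C₁] [Fintype C₂] [DecidableEq X₁] [DecidableEq X₂] [DecidableEq Y]
    [DecidableEq C₁] [DecidableEq C₂] [Nonempty X₂] (Ext : X₁ × X₂ → Y)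
    {ρ₁ : Matrix (X₁ × C₁) (X₁ × C₁) ℂ} {ρ₂ : Matrix (X₂ × C₂) (X₂ × C₂) ℂ}
    (hρ₁ : IsDensity ρ₁) (hρ₂ : IsDensity ρ₂) :
    ∃ Λ : X₂ → Matrix C₂ C₂ ℂ, (∀ c, (Λ c).PosSemidef) ∧ ∑ c, Λ c = 1 ∧
      strongError Ext (productState ρ₁ ρ₂) ≤ √(Fintype.card Y *
        (2 * strongError Ext (productState (measured ρ₁ fun _ : Unit => 1) (measured ρ₂ Λ))) / 4) := by
  obtain ⟨R, Λ, hR, hRR, hΛ₀, hΛ, hτ⟩ :=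
    exists_prettyGoodMeasurement fun y => block_posSemidef hρ₂.1 y
  refine ⟨Λ, hΛ₀, hΛ, ?_⟩
  let p : X₁ → ℝ := fun x => (block ρ₁ x).trace.re
  -- Outcomes of the measurement are labelled by X₂ itself, so w is the joint distribution of y and
  -- a guess c of it.
  let w : X₂ → X₂ → ℝ := fun y c => (block ρ₂ y * Λ c).trace.re
  let L : Y → X₁ → Matrix C₂ C₂ ℂ := fun z x => ∑ y, (extDev Ext z x y : ℂ) • Λ y
  let D : Y → X₁ → Matrix C₂ C₂ ℂ := fun z x => ∑ y, (extDev Ext z x y : ℂ) • block ρ₂ y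
  have hherm {T : X₂ → Matrix C₂ C₂ ℂ} (hT : ∀ y, (T y).PosSemidef) (z x) :
      (∑ y, (extDev Ext z x y : ℂ) • T y).IsHermitian := by
    simp only [IsHermitian, conjTranspose_sum, conjTranspose_smul, (hT _).isHermitian.eq]
    simp
  have hD : ∀ z x, D z x = R * L z x * R := fun z x => by
    simp only [D, L, Finset.mul_sum, Finset.sum_mul, mul_smul_comm, smul_mul_assoc, ← hτ]
  choose S P N hS hSS hP hN hPN hSH _ using
    fun z x => exists_jordan_decomposition (hherm (fun y => block_posSemidef hρ₂.1 y) z x)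
  have hp : ∀ x, 0 ≤ p x := fun x =>
    (Complex.le_def.1 (block_posSemidef hρ₁.1 x).trace_nonneg).1
  have hp1 : ∑ x, p x = 1 := by
    rw [← Complex.re_sum, sum_trace_block, hρ₁.2, Complex.one_re]
  have hRtr : (R * R).trace.re = 1 := by
    rw [hRR, trace_sum, sum_trace_block, hρ₂.2, Complex.one_re]
  have hLD : ∀ z x, (L z x * D z x).trace.re
      = ∑ c, extDev Ext z x c * ∑ y, extDev Ext z x y * w y c := fun z x => by
    simp only [L, D, w, Finset.sum_mul, Finset.mul_sum, trace_sum, Complex.re_sum, smul_mul_assoc,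
      mul_smul_comm, trace_smul, smul_eq_mul, Complex.re_ofReal_mul]
    rw [Finset.sum_comm]
    refine Finset.sum_congr rfl fun c _ => Finset.sum_congr rfl fun y _ => ?_
    rw [trace_mul_comm]
    ring
  have ht : ∀ z x, (P z x + N z x).trace.re ^ 2
      ≤ ∑ c, |∑ y, extDev Ext z x y * w y c| := fun z x => by
    have h := trace_reflection_mul_sq_le (hS z x) (hSS z x) hR (hherm hΛ₀ z x)
    rw [hRtr, one_mul] at h
    change (S z x * (R * L z x * R)).trace.re ^ 2 ≤ (L z x * (R * L z x * R)).trace.re at h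
    rw [← hD, hLD] at h
    rw [← hSH]
    -- The coefficient `extDev Ext z x c` is discarded using its bound by 1.
    refine h.trans (Finset.sum_le_sum fun c _ => (le_abs_self _).trans ?_)
    rw [abs_mul]
    exact mul_le_of_le_one_left (abs_nonneg _) (abs_extDev_le Ext z x c)
  have hcl : strongError Ext (productState (measured ρ₁ fun _ : Unit => 1) (measured ρ₂ Λ))
      = (∑ z, ∑ x, ∑ c, |p x * ∑ y, extDev Ext z x y * w y c|) / 2 := by
    rw [← strongError_diagonal]
    simp only [measured, mul_one, p, w]
  refine (strongError_le_of_decomposition Ext hρ₁.1 ρ₂ hP hN hPN).trans ?_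
  rw [hcl, mul_div_cancel₀ _ two_ne_zero]
  have h := half_sum_mul_le_sqrt (ι := Y × X₁) (p := fun i => p i.2)
    (t := fun i => (P i.1 i.2 + N i.1 i.2).trace.re)
    (a := fun i => ∑ c, |∑ y, extDev Ext i.1 i.2 y * w y c|) (M := Fintype.card Y)
    (b := ∑ z, ∑ x, ∑ c, |p x * ∑ y, extDev Ext z x y * w y c|)
    (fun i => hp i.2) (fun i => ht i.1 i.2) (by simp [Fintype.sum_prod_type, hp1])
    (Nat.cast_nonneg _) (by
      rw [Fintype.sum_prod_type]
      refine (Finset.sum_congr rfl fun z _ => Finset.sum_congr rfl fun x _ => ?_).le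
      rw [Finset.mul_sum]
      refine Finset.sum_congr rfl fun c _ => ?_
      rw [abs_mul, abs_of_nonneg (hp x)])
  simpa only [Fintype.sum_prod_type] using h

end TwoSource

theorem mainTheorem2 {n₁ n₂ m : ℕ} (k₁ k₂ ε : ℝ) (hε : 0 ≤ ε)
    (Ext : TwoSource.BitString n₁ × TwoSource.BitString n₂ → TwoSource.BitString m)
    (hExt : TwoSource.IsStrongExtractorClassical k₁ k₂ ε Ext) :
    TwoSource.IsStrongExtractorQuantum k₁ k₂ (Real.sqrt ((2 : ℝ) ^ ((m : ℝ) - 1) * ε)) Ext := by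
  intro C₁ C₂ _ _ _ _ ρ₁ ρ₂ hρ₁ hρ₂ _ _ hk₁ hk₂
  obtain ⟨Λ, hΛ₀, hΛ, h⟩ := TwoSource.exists_measurement_strongError_le Ext hρ₁ hρ₂
  -- The one-outcome measurement of C₁ amounts to discarding it.
  have h1 : ∀ _ : Unit, (1 : Matrix C₁ C₁ ℂ).PosSemidef := fun _ => Matrix.PosSemidef.one
  have h1' : ∑ _ : Unit, (1 : Matrix C₁ C₁ ℂ) = 1 := by simp
  have hcl := hExt Unit _ _ _ (TwoSource.measured_isDensity hρ₁ h1 h1')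
    (TwoSource.measured_isDensity hρ₂ hΛ₀ hΛ) (Matrix.isDiag_diagonal _)
    (Matrix.isDiag_diagonal _) (hk₁.trans (TwoSource.minEntropy_le_minEntropy_measured h1 h1'))
    (hk₂.trans (TwoSource.minEntropy_le_minEntropy_measured hΛ₀ hΛ))
  refine h.trans (Real.sqrt_le_sqrt ?_)
  have hcard : (Fintype.card (TwoSource.BitString m) : ℝ) = 2 ^ m := by simp
  rw [hcard, Real.rpow_sub two_pos, Real.rpow_natCast, Real.rpow_one]
  have := mul_le_mul_of_nonneg_left hcl (pow_nonneg (zero_le_two (α := ℝ)) m)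
  linarith
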